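/- Let $G$ be a countable group, $M\subset G$ a finite subset, $V$ a finite vector space over a field, and let $\mathcal L(V^M,V)$ be the set of linear maps $V^M\to V$. For $s\in\mathcal L(V^M,V)^G$ let $\sigma_s\colon V^G\to V^G$ be the linear non-uniform cellular automaton (NUCA) $\sigma_s(x)(g)=s(g)\big((g^{-1}x)|_M\big)$, where $(gx)(h)=x(g^{-1}h)$. Call two configurations (maps with domain $G$) asymptotic if they agree outside a finite subset of $G$. The map $\sigma_s$ is post-surjective if for all $x,y\in V^G$ with $y$ asymptotic to $\sigma_s(x)$ there is $z\in V^G$ asymptotic to $x$ with $\sigma_s(z)=y$; it is stably post-surjective if $\sigma_p$ is post-surjective for every $p$ in $\Sigma(s)=\overline{\{gs: g\in G\}}$, the closure of the shift orbit of $s$ in $\mathcal L(V^M,V)^G$ for the prodiscrete topology; it is invertible if it is bijective and there are a finite subset $N\subset G$ and maps $t(g)\colon V^N\to V$ $(g\in G)$ such that $\sigma_s^{-1}(x)(g)=t(g)\big((g^{-1}x)|_N\big)$ for all $x\in V^G$, $g\in G$. Suppose that $s\in\mathcal L(V^M,V)^G$ is asymptotic to a constant configuration. Then $\sigma_s$ is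 invertible in each of the following cases: (i) $G$ is amenable and $\sigma_s$ is post-surjective; (ii) $G$ is residually finite and $\sigma_s$ is stably post-surjective. -/

import Mathlib

namespace NUCA

/-- The Bernoulli shift: `(g x)(h) = x (g⁻¹ h)`. -/
def shift {G A : Type*} [Group G] (g : G) (x : G → A) : G → A :=
  fun h => x (g⁻¹ * h)

/-- Two configurations are asymptotic if they agree outside some finite set. -/
def Asymptotic {G A : Type*} (x y : G → A) : Prop :=
  ∃ E : Set G, E.Finite ∧ ∀ g, g ∉ E → x g = y g

/-- `Σ(x)`: the closure of the shift orbit of `x` for the prodiscrete topology, that is, the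
product topology on `G → A` of the discrete topologies on the factors `A`. -/
def orbitClosure {G A : Type*} [Group G] (x : G → A) : Set (G → A) :=
  @closure (G → A) (@Pi.topologicalSpace G (fun _ => A) (fun _ => ⊥))
    (Set.range fun g : G => shift g x)

/-- The non-uniform cellular automaton `σ_s` with memory `M` and configuration of local defining
maps `s`: `σ_s(x)(g) = s(g)((g⁻¹ x)|_M)`. -/
def nuca {G A : Type*} [Group G] {M : Set G} (s : G → (M → A) → A) (x : G → A) : G → A :=
  fun g => s g (fun m : M => shift g⁻¹ x m)

/-- The linear non-uniform cellular automaton `σ_s` for `s ∈ L(V^M, V)^G`. -/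
def linearNuca {G K V : Type*} [Group G] [Field K] [AddCommGroup V] [Module K V] {M : Set G}
    (s : G → ((M → V) →ₗ[K] V)) : (G → V) → (G → V) :=
  nuca fun g => ⇑(s g)

/-- Post-surjectivity: if `y` is asymptotic to `τ x`, then `y = τ z` with `z` asymptotic to `x`. -/
def PostSurjective {G A : Type*} (τ : (G → A) → (G → A)) : Prop :=
  ∀ x y : G → A, Asymptotic y (τ x) → ∃ z : G → A, Asymptotic z x ∧ τ z = y

/-- `σ_s` is stably post-surjective: `σ_p` is post-surjective for every `p ∈ Σ(s)`. -/
def StablyPostSurjective {G K V : Type*} [Group G] [Field K] [AddCommGroup V] [Module K V]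
    {M : Set G} (s : G → ((M → V) →ₗ[K] V)) : Prop :=
  ∀ p ∈ orbitClosure s, PostSurjective (linearNuca p)

/-- `τ` is invertible: it is bijective and its inverse is a non-uniform cellular automaton with
finite memory. -/
def Invertible {G A : Type*} [Group G] (τ : (G → A) → (G → A)) : Prop :=
  Function.Bijective τ ∧
    ∃ N : Set G, N.Finite ∧ ∃ t : G → (N → A) → A,
      Function.LeftInverse (nuca t) τ ∧ Function.RightInverse (nuca t) τ

/-- Amenability of a discrete group, by the Følner condition: for every finite `K ⊆ G` and
`ε > 0` there is a nonempty finite `F ⊆ G` with `|F k \ F| ≤ ε |F|` for all `k ∈ K`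
(`g ↦ g k` is a bijection from the set counted below onto `F k \ F`). -/
def IsAmenable (G : Type*) [Group G] : Prop :=
  ∀ (K : Finset G) (ε : ℝ), 0 < ε → ∃ F : Finset G, F.Nonempty ∧
    ∀ k ∈ K, ({g : G | g ∈ F ∧ g * k ∉ F}.ncard : ℝ) ≤ ε * F.card

end NUCA

/-! On finitely supported configurations `σ_s` acts as `T = C + F`. Here `C` is the uniform
automaton of the constant limit `c`, and `F` has finite rank because `s` differs from `c` at
finitely many places only. Post-surjectivity makes `T` surjective.

If `C` is injective, a Fredholm-index argument (`bijective_of_injective_of_surjective_add`) makes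
`C` and `T` bijective: the index of `C` is at most 0, that of `T` at least 0, and a finite-rank
perturbation does not change it. The inverse of `C` commutes with translations, so it has finite
memory; that of `T` differs from it in finitely many columns, so it has finite memory too. Locality
carries the inverse identities from finite supports to all configurations.

There remains the injectivity of `C` for infinite `G`; finite `G` is plain linear algebra. In the
amenable case, translates of a nonzero kernel element over a Følner set span too large a space, even
allowing for the rank of `F`. In the residually finite case, `c` lies in `Σ(s)`, so `C` is itself
surjective, and finite quotients give injectivity. -/

namespace NUCA

/-! ### Uniform and finite-row operators on finite supports -/

section Operators

variable {H ι K V : Type*} [Group H] [Fintype ι] [DecidableEq ι]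
  [Field K] [AddCommGroup V] [Module K V]

/-- The uniform linear cellular automaton `x ↦ (h ↦ c (i ↦ x (h * d i)))` on finitely supported
configurations. -/
noncomputable def uniformOp (d : ι → H) (c : (ι → V) →ₗ[K] V) : (H →₀ V) →ₗ[K] (H →₀ V) :=
  ∑ i, Finsupp.mapRange.linearMap (c ∘ₗ LinearMap.single K (fun _ => V) i) ∘ₗ
    Finsupp.lmapDomain V K (fun h => h * (d i)⁻¹)

theorem uniformOp_apply (d : ι → H) (c : (ι → V) →ₗ[K] V) (x : H →₀ V) (h : H) :
    uniformOp d c x h = c (fun i => x (h * d i)) := by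
  have key : ∀ i, (Finsupp.mapDomain (fun h => h * (d i)⁻¹) x) h = x (h * d i) := fun i => by
    have := Finsupp.mapDomain_apply (mul_left_injective (d i)⁻¹) x (h * d i)
    simpa using this
  rw [← Finset.univ_sum_single (fun i => x (h * d i))]
  simp [uniformOp, key, Finsupp.finsetSum_apply]

theorem uniformOp_mapDomain {Q : Type*} [Group Q] (f : H →* Q) (d : ι → H)
    (c : (ι → V) →ₗ[K] V) (x : H →₀ V) :
    uniformOp (fun i => f (d i)) c (Finsupp.mapDomain f x) =
      Finsupp.mapDomain f (uniformOp d c x) := by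
  simp only [uniformOp, LinearMap.sum_apply, LinearMap.comp_apply, Finsupp.lmapDomain_apply,
    Finsupp.mapRange.linearMap_apply]
  rw [← Finsupp.lmapDomain_apply V K f (∑ i, _), map_sum]
  refine Finset.sum_congr rfl fun i _ => ?_
  rw [Finsupp.lmapDomain_apply, Finsupp.mapDomain_mapRange _ _ _ _ (map_add _),
    ← Finsupp.mapDomain_comp, ← Finsupp.mapDomain_comp]
  congr 2
  funext h
  simp

theorem mapDomain_mul_left_apply (g : H) (x : H →₀ V) (h : H) :
    Finsupp.mapDomain (g * ·) x h = x (g⁻¹ * h) := by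
  have := Finsupp.mapDomain_apply (mul_right_injective g) x (g⁻¹ * h)
  simpa using this

theorem uniformOp_translate (d : ι → H) (c : (ι → V) →ₗ[K] V) (g : H) (x : H →₀ V) :
    uniformOp d c (Finsupp.mapDomain (g * ·) x) =
      Finsupp.mapDomain (g * ·) (uniformOp d c x) := by
  ext h
  simp only [uniformOp_apply, mapDomain_mul_left_apply, mul_assoc]

/-- The operator `x ↦ (h ↦ b h (i ↦ x (h * d i)))` with rows `b` supported in a finite set. -/
noncomputable def finiteRowsOp (d : ι → H) (E : Finset H) (b : H → (ι → V) →ₗ[K] V) :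
    (H →₀ V) →ₗ[K] (H →₀ V) :=
  ∑ h ∈ E, Finsupp.lsingle h ∘ₗ b h ∘ₗ LinearMap.pi fun i => Finsupp.lapply (h * d i)

open Classical in
omit [Fintype ι] [DecidableEq ι] in
theorem finiteRowsOp_apply (d : ι → H) (E : Finset H) (b : H → (ι → V) →ₗ[K] V) (x : H →₀ V)
    (h : H) :
    finiteRowsOp d E b x h = if h ∈ E then b h (fun i => x (h * d i)) else 0 := by
  have : ∀ h' : H, (LinearMap.pi fun i => Finsupp.lapply (R := K) (M := V) (h' * d i)) x =
      (fun i => x (h' * d i)) := fun _ => rfl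
  simp [finiteRowsOp, Finsupp.finsetSum_apply, Finsupp.single_apply]
  split_ifs <;> rfl

omit [Fintype ι] [DecidableEq ι] in
theorem finiteRowsOp_range_finite [FiniteDimensional K V] (d : ι → H) (E : Finset H)
    (b : H → (ι → V) →ₗ[K] V) :
    Module.Finite K (LinearMap.range (finiteRowsOp d E b)) := by
  classical
  have hle : LinearMap.range (finiteRowsOp d E b) ≤
      LinearMap.range (∑ h : E, Finsupp.lsingle (h : H) ∘ₗ
        LinearMap.proj (R := K) (φ := fun _ : E => V) h) := by
    rintro _ ⟨x, rfl⟩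
    refine ⟨fun h => b h (fun i => x (h * d i)), ?_⟩
    rw [finiteRowsOp, LinearMap.sum_apply, LinearMap.sum_apply, ← Finset.sum_coe_sort E]
    rfl
  exact Submodule.finiteDimensional_of_le hle

end Operators

/-! ### Finite-rank perturbations -/

section LinearAlgebra

variable {K X : Type*} [Field K] [AddCommGroup X] [Module K X]

/-- A finite-rank perturbation of an injective operator cannot gain surjectivity. -/
theorem bijective_of_injective_of_surjective_add (C F : X →ₗ[K] X)
    (hF : Module.Finite K (LinearMap.range F)) (hC : Function.Injective C)
    (hT : Function.Surjective (C + F)) :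
    Function.Bijective C ∧ Function.Bijective (C + F) := by
  set N := LinearMap.ker F with hN
  have hNfin : Module.Finite K (X ⧸ N) :=
    Module.Finite.equiv (LinearMap.quotKerEquivRange F).symm
  set L := N.map C with hL
  have hTN : ∀ x ∈ N, (C + F) x = C x := fun x hx => by
    simp [LinearMap.mem_ker.1 hx]
  -- `C` and `C + F` agree on `N = ker F`, so both descend to maps between the same quotients. One
  -- is injective, the other surjective, and equality of finite dimensions makes both bijective.
  let f : (X ⧸ N) →ₗ[K] (X ⧸ L) := N.mapQ L C (Submodule.map_le_iff_le_comap.1 le_rfl)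
  let g : (X ⧸ N) →ₗ[K] (X ⧸ L) := N.mapQ L (C + F) fun x hx => by
    rw [Submodule.mem_comap, hTN x hx]
    exact Submodule.mem_map_of_mem hx
  have hg : Function.Surjective g := by
    intro y
    obtain ⟨y, rfl⟩ := L.mkQ_surjective y
    obtain ⟨x, rfl⟩ := hT y
    exact ⟨N.mkQ x, rfl⟩
  have hf : Function.Injective f := by
    rw [injective_iff_map_eq_zero]
    intro y hy
    obtain ⟨y, rfl⟩ := N.mkQ_surjective y
    have : C y ∈ L := (Submodule.Quotient.mk_eq_zero L).1 hy
    obtain ⟨z, hz, hzy⟩ := this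
    rw [← hC hzy]
    exact (Submodule.Quotient.mk_eq_zero N).2 hz
  have hLfin : Module.Finite K (X ⧸ L) := Module.Finite.of_surjective g hg
  have hrank : Module.finrank K (X ⧸ N) = Module.finrank K (X ⧸ L) :=
    le_antisymm (LinearMap.finrank_le_finrank_of_injective hf)
      (LinearMap.finrank_le_finrank_of_surjective hg)
  have hf' : Function.Surjective f :=
    (LinearMap.injective_iff_surjective_of_finrank_eq_finrank hrank).1 hf
  have hg' : Function.Injective g :=
    (LinearMap.injective_iff_surjective_of_finrank_eq_finrank hrank).2 hg
  refine ⟨⟨hC, fun y => ?_⟩, ?_, hT⟩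
  · obtain ⟨q, hq⟩ := hf' (L.mkQ y)
    obtain ⟨x, rfl⟩ := N.mkQ_surjective q
    have : C x - y ∈ L := (Submodule.Quotient.eq L).1 hq
    obtain ⟨z, -, hz⟩ := this
    exact ⟨x - z, by rw [map_sub, hz]; abel⟩
  · rw [injective_iff_map_eq_zero]
    intro x hx
    have h0 : g (N.mkQ x) = 0 := by
      change L.mkQ ((C + F) x) = 0
      rw [hx, map_zero]
    have hxN : x ∈ N :=
      (Submodule.Quotient.mk_eq_zero N).1 ((injective_iff_map_eq_zero g).1 hg' _ h0)
    rw [hTN x hxN] at hx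
    exact (injective_iff_map_eq_zero C).1 hC x hx

end LinearAlgebra

/-! ### Injectivity of `C` through finite quotients -/

section ResiduallyFinite

variable {G : Type*} [Group G]

theorem exists_normal_finiteIndex_forall_notMem [Group.ResiduallyFinite G] (T : Finset G)
    (hT : (1 : G) ∉ T) : ∃ N : Subgroup G, N.Normal ∧ N.FiniteIndex ∧ ∀ t ∈ T, t ∉ N := by
  classical
  induction T using Finset.induction_on with
  | empty => exact ⟨⊤, inferInstance, inferInstance, by simp⟩
  | insert a T _ ih =>
    simp only [Finset.mem_insert, not_or] at hT
    obtain ⟨N, h1, h2, h3⟩ := ih hT.2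
    obtain ⟨N', hN'⟩ := Group.exists_finiteIndexNormalSubgroup_notMem a (Ne.symm hT.1)
    have := N'.isNormal'
    have := N'.isFiniteIndex'
    refine ⟨N ⊓ N'.toSubgroup, inferInstance, inferInstance, fun t ht => ?_⟩
    rintro ⟨hN, hN2⟩
    rcases Finset.mem_insert.1 ht with rfl | ht
    · exact hN' hN2
    · exact h3 t ht hN

variable {ι K V : Type*} [Fintype ι] [DecidableEq ι]
  [Field K] [AddCommGroup V] [Module K V] [FiniteDimensional K V]

/-- Stable finiteness of group rings of residually finite groups, in the form needed here. -/
theorem uniformOp_injective_of_residuallyFinite [Group.ResiduallyFinite G] (d : ι → G)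
    (c : (ι → V) →ₗ[K] V) (hsurj : Function.Surjective (uniformOp d c)) :
    Function.Injective (uniformOp d c) := by
  classical
  rw [injective_iff_map_eq_zero]
  intro k hk
  -- Excluding these quotients of support points keeps the support of `k` embedded in `G ⧸ N`, so
  -- `k` does not vanish there unless it is zero.
  obtain ⟨N, hN, hfin, hT⟩ := exists_normal_finiteIndex_forall_notMem
    (((k.support ×ˢ k.support).image fun p => p.1⁻¹ * p.2).erase 1) (by simp)
  let f : G →* G ⧸ N := QuotientGroup.mk' N
  have hinj : Set.InjOn f (k.support : Set G) := by
    intro a ha b hb hab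
    by_contra hne
    refine hT (a⁻¹ * b) ?_ (QuotientGroup.eq.1 hab)
    refine Finset.mem_erase.2 ⟨fun h => hne (inv_mul_eq_one.1 h), ?_⟩
    exact Finset.mem_image.2 ⟨(a, b), Finset.mem_product.2 ⟨ha, hb⟩, rfl⟩
  have hfS : Function.Surjective (uniformOp (fun i => f (d i)) c) := by
    intro y
    obtain ⟨y, rfl⟩ := Finsupp.mapDomain_surjective (QuotientGroup.mk'_surjective N) y
    obtain ⟨x, rfl⟩ := hsurj y
    exact ⟨Finsupp.mapDomain f x, uniformOp_mapDomain f d c x⟩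
  have hfI := LinearMap.injective_iff_surjective.2 hfS
  have h0 : Finsupp.mapDomain f k = 0 := by
    apply (injective_iff_map_eq_zero _).1 hfI
    rw [uniformOp_mapDomain, hk, Finsupp.mapDomain_zero]
  exact Finsupp.mapDomain_injOn (k.support : Set G) hinj (by simp) (by simp)
    (h0.trans (Finsupp.mapDomain_zero).symm)

end ResiduallyFinite

end NUCA

namespace NUCA

/-! ### Injectivity of `C` by counting dimensions on Følner sets -/

section Amenable

variable {G : Type*} [Group G]

theorem IsAmenable.exists_large_folner [Infinite G] (hG : IsAmenable G) (S : Finset G) (N : ℕ) :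
    ∃ A : Finset G, A.Nonempty ∧ N ≤ A.card ∧
      ∀ k ∈ S, N * {g : G | g ∈ A ∧ g * k ∉ A}.ncard ≤ A.card := by
  classical
  obtain ⟨Z, hZ⟩ := Infinite.exists_subset_card_eq G N
  -- If `A.card < N`, the constant `1 / (N + 1)` forces the boundary counts for `Z` to vanish; then
  -- `a * Z ⊆ A`, so `A` has at least `N` elements after all.
  obtain ⟨A, ⟨a, ha⟩, hA⟩ := hG (S ∪ Z) (1 / (N + 1)) (by positivity)
  have hcount : ∀ k ∈ S ∪ Z, (N + 1) * {g : G | g ∈ A ∧ g * k ∉ A}.ncard ≤ A.card := by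
    intro k hk
    have h := hA k hk
    rw [one_div, inv_mul_eq_div, le_div_iff₀ (by positivity)] at h
    have : ((((N + 1) * {g : G | g ∈ A ∧ g * k ∉ A}.ncard : ℕ)) : ℝ) ≤ (A.card : ℕ) := by
      push_cast
      linarith
    exact_mod_cast this
  refine ⟨A, ⟨a, ha⟩, ?_, fun k hk => ?_⟩
  · by_contra! hlt
    have hsub : Z.image (a * ·) ⊆ A := by
      intro _ hx
      obtain ⟨z, hz, rfl⟩ := Finset.mem_image.1 hx
      by_contra hnot
      have hfin : {g : G | g ∈ A ∧ g * z ∉ A}.Finite :=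
        A.finite_toSet.subset fun g hg => hg.1
      have hpos : 0 < {g : G | g ∈ A ∧ g * z ∉ A}.ncard :=
        (Set.ncard_pos hfin).2 ⟨a, ha, hnot⟩
      have := hcount z (Finset.mem_union_right _ hz)
      nlinarith
    have := Finset.card_le_card hsub
    rw [Finset.card_image_of_injective _ (mul_right_injective a), hZ] at this
    omega
  · have := hcount k (Finset.mem_union_left _ hk)
    nlinarith

variable {K V : Type*} [Field K] [AddCommGroup V] [Module K V]

/-- The translates of a nonzero finitely supported configuration by a finite set `A` span a
space of dimension proportional to the size of `A`. -/
theorem card_le_card_support_mul_finrank_span_translates {k : G →₀ V} (hk : k ≠ 0)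
    (A : Finset G) :
    A.card ≤ k.support.card *
      Module.finrank K
        (Submodule.span K ((fun g : G => Finsupp.mapDomain (g * ·) k) '' (A : Set G))) := by
  classical
  set τ : G → (G →₀ V) := fun g => Finsupp.mapDomain (g * ·) k with hτ
  obtain ⟨b, hb, hspan, hlin⟩ := exists_linearIndependent K (τ '' (A : Set G))
  have hbfin : b.Finite := (A.finite_toSet.image τ).subset hb
  lift b to Finset (G →₀ V) using hbfin
  have hrank : Module.finrank K (Submodule.span K (τ '' (A : Set G))) = b.card := by
    rw [← hspan, finrank_span_finset_eq_card hlin]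
  rw [hrank]
  obtain ⟨s, hs⟩ := Finsupp.support_nonempty_iff.2 hk
  -- Evaluation at a point outside all supports of the basis would kill the span, yet `τ a (a * s) =
  -- k s ≠ 0`.
  have hcov : A.image (· * s) ⊆ b.biUnion fun v => v.support := by
    intro _ hx
    obtain ⟨a, ha, rfl⟩ := Finset.mem_image.1 hx
    by_contra hnot
    have hle : Submodule.span K (b : Set (G →₀ V)) ≤
        LinearMap.ker (Finsupp.lapply (R := K) (M := V) (a * s)) := by
      rw [Submodule.span_le]
      intro v hv
      by_contra hne
      exact hnot (Finset.mem_biUnion.2 ⟨v, hv, Finsupp.mem_support_iff.2 hne⟩)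
    have hmem : τ a ∈ Submodule.span K (b : Set (G →₀ V)) := by
      rw [hspan]
      exact Submodule.subset_span ⟨a, ha, rfl⟩
    have h0 : τ a (a * s) = 0 := hle hmem
    rw [hτ, mapDomain_mul_left_apply, inv_mul_cancel_left] at h0
    exact Finsupp.mem_support_iff.1 hs h0
  calc A.card = (A.image (· * s)).card :=
        (Finset.card_image_of_injective _ (mul_left_injective s)).symm
    _ ≤ (b.biUnion fun v => v.support).card := Finset.card_le_card hcov
    _ ≤ b.card * k.support.card := by
        refine Finset.card_biUnion_le_card_mul _ _ _ fun v hv => ?_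
        obtain ⟨a, -, rfl⟩ := hb hv
        exact (Finset.card_le_card Finsupp.mapDomain_support).trans Finset.card_image_le
    _ = k.support.card * b.card := mul_comm _ _

omit [Group G] in
theorem finrank_supported_finset [FiniteDimensional K V] (B : Finset G) :
    Module.finrank K (Finsupp.supported V K (B : Set G)) = B.card * Module.finrank K V := by
  rw [(Finsupp.supportedEquivFinsupp (M := V) (R := K) (B : Set G)).finrank_eq,
    (Finsupp.linearEquivFunOnFinite K V (B : Set G)).finrank_eq, Module.finrank_pi_fintype]
  simp

variable {ι : Type*} [Fintype ι] [DecidableEq ι] [FiniteDimensional K V]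

/-- A Garden-of-Eden type statement: over an infinite amenable group, a uniform linear cellular
automaton that has a surjective finite-rank local perturbation on finitely supported
configurations is pre-injective. -/
theorem uniformOp_injective_of_isAmenable [Infinite G] (hG : IsAmenable G) (d : ι → G)
    (c : (ι → V) →ₗ[K] V) (F : (G →₀ V) →ₗ[K] (G →₀ V))
    (hF : Module.Finite K (LinearMap.range F))
    (hloc : ∀ x g, (∀ i, x (g * d i) = 0) → F x g = 0)
    (hsurj : Function.Surjective (uniformOp d c + F)) :
    Function.Injective (uniformOp d c) := by
  classical
  rw [injective_iff_map_eq_zero]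
  intro k hk
  by_contra hk0
  set T := uniformOp d c + F with hT
  set n := Module.finrank K V with hn
  set r := Module.finrank K (LinearMap.range F) with hr
  set S := k.support ∪ Finset.univ.image d with hS
  -- `N` is chosen so that the final estimate reads `N * A.card ≤ (N - 1) * A.card`.
  obtain ⟨A, hAne, hNA, hA⟩ := hG.exists_large_folner S
    (k.support.card * r + k.support.card * n * S.card + 1)
  set N := k.support.card * r + k.support.card * n * S.card + 1 with hN
  set Bd : Finset G := S.biUnion fun m => (A.filter fun g => g * m ∉ A).image (· * m) with hbd
  set B := A ∪ Bd with hB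
  have hAB : ∀ g ∈ A, ∀ m ∈ S, g * m ∈ B := by
    intro g hg m hm
    by_cases h : g * m ∈ A
    · exact Finset.mem_union_left _ h
    · exact Finset.mem_union_right _ (Finset.mem_biUnion.2
        ⟨m, hm, Finset.mem_image.2 ⟨g, Finset.mem_filter.2 ⟨hg, h⟩, rfl⟩⟩)
  have hbdcard : N * Bd.card ≤ S.card * A.card := by
    calc N * Bd.card ≤ N * ∑ m ∈ S, {g : G | g ∈ A ∧ g * m ∉ A}.ncard := by
          refine Nat.mul_le_mul_left _ (Finset.card_biUnion_le.trans
            (Finset.sum_le_sum fun m _ => Finset.card_image_le.trans (le_of_eq ?_)))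
          rw [← Set.ncard_coe_finset]
          congr 1
          ext g
          simp
      _ = ∑ m ∈ S, N * {g : G | g ∈ A ∧ g * m ∉ A}.ncard := Finset.mul_sum _ _ _
      _ ≤ S.card * A.card := by
          rw [← smul_eq_mul (a := S.card)]
          exact Finset.sum_le_card_nsmul _ _ _ hA
  have hBcard : B.card ≤ A.card + Bd.card := Finset.card_union_le _ _
  let U := Finsupp.supported V K (B : Set G)
  let W : U →ₗ[K] Finsupp.supported V K (A : Set G) :=
    Finsupp.restrictDom V K (A : Set G) ∘ₗ T ∘ₗ U.subtype
  have hUfin : Module.Finite K U :=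
    Module.Finite.equiv (Finsupp.supportedEquivFinsupp (M := V) (R := K) (B : Set G)).symm
  -- Values of `T x` on `A` depend only on `x` over `B`, so a preimage may be truncated to `B`.
  have hW : Function.Surjective W := by
    rintro ⟨y, hy⟩
    obtain ⟨x, rfl⟩ := hsurj y
    refine ⟨Finsupp.restrictDom V K (B : Set G) x, ?_⟩
    ext g
    by_cases hg : g ∈ A
    · have h0 : T ((Finsupp.restrictDom V K (B : Set G) x : G →₀ V) - x) g = 0 := by
        have hz : ∀ i, ((Finsupp.restrictDom V K (B : Set G) x : G →₀ V) - x) (g * d i) = 0 := by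
          intro i
          have := hAB g hg (d i) (Finset.mem_union_right _
            (Finset.mem_image_of_mem d (Finset.mem_univ i)))
          simp [this]
        rw [hT, LinearMap.add_apply, Finsupp.add_apply, hloc _ _ hz, uniformOp_apply, add_zero]
        simp only [hz]
        exact map_zero c
      rw [map_sub, Finsupp.sub_apply, sub_eq_zero] at h0
      simpa [W, Finsupp.filter_apply, hg] using h0
    · have h1 : (T x) g = 0 := (Finsupp.mem_supported' K _).1 hy g hg
      simpa [W, Finsupp.filter_apply, hg] using h1.symm
  set P := Submodule.span K ((fun g : G => Finsupp.mapDomain (g * ·) k) '' (A : Set G)) with hP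
  have hPU : P ≤ U := by
    rw [hP, Submodule.span_le]
    rintro _ ⟨a, ha, rfl⟩
    refine (Finsupp.mem_supported K _).2 fun g hg => ?_
    obtain ⟨s, hs, rfl⟩ := Finset.mem_image.1 (Finsupp.mapDomain_support hg)
    exact hAB a ha s (Finset.mem_union_left _ hs)
  have hPker : ∀ x ∈ P, uniformOp d c x = 0 := by
    suffices P ≤ LinearMap.ker (uniformOp d c) from fun x hx => this hx
    rw [hP, Submodule.span_le]
    rintro _ ⟨a, -, rfl⟩
    simp [uniformOp_translate, hk]
  have hPfin : Module.Finite K P := Submodule.finiteDimensional_of_le hPU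
  -- On `P` the operator `T` reduces to `F`, so `T` vanishes on a subspace of codimension at most
  -- `r`.
  have hPr : Module.finrank K P ≤ r + Module.finrank K (LinearMap.ker W) := by
    rw [← LinearMap.finrank_range_add_finrank_ker (F.domRestrict P)]
    refine add_le_add (Submodule.finrank_mono ?_) ?_
    · rintro _ ⟨x, rfl⟩
      exact ⟨x, rfl⟩
    · let j : LinearMap.ker (F.domRestrict P) →ₗ[K] LinearMap.ker W :=
        (Submodule.inclusion hPU ∘ₗ Submodule.subtype _).codRestrict _ fun x => by
          have h1 : F (x : P) = 0 := x.2
          have h2 : T (x : P) = 0 := by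
            rw [hT, LinearMap.add_apply, h1, hPker _ (x : P).2, add_zero]
          rw [LinearMap.mem_ker]
          change Finsupp.restrictDom V K (A : Set G) (T (x : P)) = 0
          rw [h2, map_zero]
      refine LinearMap.finrank_le_finrank_of_injective (f := j) fun x y hxy => ?_
      apply Subtype.ext
      apply Subtype.ext
      exact congrArg (fun z : LinearMap.ker W => ((z : U) : G →₀ V)) hxy
  have hdim := LinearMap.finrank_range_add_finrank_ker W
  rw [LinearMap.range_eq_top.2 hW, finrank_top, finrank_supported_finset,
    finrank_supported_finset, ← hn] at hdim
  have hker : Module.finrank K (LinearMap.ker W) ≤ Bd.card * n := by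
    have := Nat.mul_le_mul_right n hBcard
    rw [add_mul] at this
    omega
  have hmain : A.card ≤ k.support.card * (r + Bd.card * n) :=
    (card_le_card_support_mul_finrank_span_translates (K := K) hk0 A).trans
      (Nat.mul_le_mul_left _ (hPr.trans (Nat.add_le_add_left hker r)))
  have hApos : 0 < A.card := hAne.card_pos
  have hfinal : N * A.card ≤ (k.support.card * r + k.support.card * n * S.card) * A.card := by
    calc N * A.card ≤ N * (k.support.card * (r + Bd.card * n)) := Nat.mul_le_mul_left _ hmain
      _ = k.support.card * r * N + k.support.card * n * (N * Bd.card) := by ring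
      _ ≤ k.support.card * r * A.card + k.support.card * n * (S.card * A.card) :=
          add_le_add (Nat.mul_le_mul_left _ hNA) (Nat.mul_le_mul_left _ hbdcard)
      _ = _ := by ring
  have := Nat.le_of_mul_le_mul_right hfinal hApos
  omega

end Amenable

end NUCA

namespace NUCA

/-! ### Extension from finite supports to all configurations -/

section Locality

variable {G A : Type*}

/-- Every output coordinate depends on finitely many input coordinates. -/
def IsLocal (τ : (G → A) → (G → A)) : Prop :=
  ∀ g, ∃ S : Finset G, ∀ x y : G → A, (∀ a ∈ S, x a = y a) → τ x g = τ y g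

theorem IsLocal.comp {τ ρ : (G → A) → (G → A)} (hτ : IsLocal τ) (hρ : IsLocal ρ) :
    IsLocal (τ ∘ ρ) := by
  classical
  intro g
  obtain ⟨S, hS⟩ := hτ g
  choose U hU using hρ
  exact ⟨S.biUnion U, fun x y h => hS _ _ fun a ha => hU a x y fun b hb =>
    h b (Finset.mem_biUnion.2 ⟨a, ha, hb⟩)⟩

theorem isLocal_nuca [Group G] {M : Set G} (hM : M.Finite) (s : G → (M → A) → A) :
    IsLocal (nuca s) := by
  classical
  intro g
  refine ⟨hM.toFinset.image (g * ·), fun x y h => ?_⟩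
  unfold nuca shift
  congr 1
  funext m
  rw [inv_inv]
  exact h _ (Finset.mem_image_of_mem _ (hM.mem_toFinset.2 m.2))

theorem IsLocal.eq_self [Zero A] {τ : (G → A) → (G → A)} (hτ : IsLocal τ)
    (h : ∀ x : G →₀ A, τ x = x) (x : G → A) : τ x = x := by
  classical
  funext g
  obtain ⟨S, hS⟩ := hτ g
  let y : G →₀ A := Finsupp.indicator (insert g S) fun a _ => x a
  have hy : ∀ a ∈ insert g S, x a = y a := fun a ha =>
    (Finsupp.indicator_of_mem ha fun a _ => x a).symm
  rw [hS x y fun a ha => hy a (Finset.mem_insert_of_mem ha), h, hy g (Finset.mem_insert_self g S)]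

end Locality

/-! ### Memory of the inverse and assembly -/

variable {G K V : Type*} [Group G] [Field K] [AddCommGroup V] [Module K V]

/-- A linear cellular automaton whose restriction to finitely supported configurations has an
inverse with uniformly bounded rows is invertible. -/
theorem invertible_of_finsupp_inverse {M : Set G} (hM : M.Finite)
    (s : G → ((M → V) →ₗ[K] V)) (T R : (G →₀ V) →ₗ[K] (G →₀ V))
    (hT : ∀ x : G →₀ V, linearNuca s x = T x) (hTR : ∀ x, T (R x) = x) (hRT : ∀ x, R (T x) = x)
    (N : Finset G) (hN : ∀ g h v, g⁻¹ * h ∉ N → R (Finsupp.single h v) g = 0) :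
    Invertible (linearNuca s) := by
  classical
  let t : G → (↥(N : Set G) → V) → V := fun g y =>
    R (∑ n : ↥(N : Set G), Finsupp.single (g * n) (y n)) g
  have ht : ∀ x : G →₀ V, nuca t x = R x := by
    intro x
    funext g
    set x' := ∑ n : ↥(N : Set G), Finsupp.single (g * (n : G)) (x (g * n)) with hx'
    have h1 : nuca t x g = R x' g := by
      simp only [nuca, shift, t, inv_inv, hx']
    have hx'apply : ∀ h, g⁻¹ * h ∈ N → x' h = x h := by
      intro h hh
      rw [hx', Finsupp.finsetSum_apply, Finset.sum_eq_single ⟨g⁻¹ * h, hh⟩]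
      · simp
      · intro n _ hn
        refine Finsupp.single_eq_of_ne fun he => hn (Subtype.ext ?_)
        simp [he]
      · simp
    have hzero : ∀ z : G →₀ V, (∀ h, g⁻¹ * h ∈ N → z h = 0) → R z g = 0 := by
      intro z hz
      rw [← Finsupp.sum_single z, Finsupp.sum, map_sum, Finsupp.finsetSum_apply]
      refine Finset.sum_eq_zero fun h _ => ?_
      by_cases hh : g⁻¹ * h ∈ N
      · simp [hz h hh]
      · exact hN _ _ _ hh
    have h2 := hzero (x' - x) fun h hh => by simp [hx'apply h hh]
    rw [map_sub, Finsupp.sub_apply, sub_eq_zero] at h2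
    rw [h1, h2]
  have hσ : IsLocal (linearNuca s) := isLocal_nuca hM _
  have hρ : IsLocal (nuca t) := isLocal_nuca N.finite_toSet t
  have hleft : Function.LeftInverse (nuca t) (linearNuca s) :=
    (hρ.comp hσ).eq_self fun x => by rw [Function.comp_apply, hT, ht, hRT]
  have hright : Function.RightInverse (nuca t) (linearNuca s) :=
    (hσ.comp hρ).eq_self fun x => by rw [Function.comp_apply, ht, hT, hTR]
  exact ⟨⟨hleft.injective, hright.surjective⟩, N, N.finite_toSet, t, hleft, hright⟩

omit [Group G] in
theorem exists_support_bound [Finite V] (L : (G →₀ V) →ₗ[K] (G →₀ V)) (S : Finset G) :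
    ∃ U : Finset G, ∀ h ∈ S, ∀ v g, L (Finsupp.single h v) g ≠ 0 → g ∈ U := by
  classical
  have := Fintype.ofFinite V
  refine ⟨S.biUnion fun h => Finset.univ.biUnion fun v => (L (Finsupp.single h v)).support,
    fun h hh v g hg => ?_⟩
  exact Finset.mem_biUnion.2 ⟨h, hh, Finset.mem_biUnion.2
    ⟨v, Finset.mem_univ v, Finsupp.mem_support_iff.2 hg⟩⟩

/-- The inverse of a finite-row perturbation of an invertible uniform operator has uniformly
bounded rows. -/
theorem exists_memory_inverse [Finite V] {ι : Type*} [Fintype ι] [DecidableEq ι] (d : ι → G)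
    (c : (ι → V) →ₗ[K] V) (E : Finset G) (b : G → (ι → V) →ₗ[K] V)
    (hC : Function.Bijective (uniformOp d c)) (R : (G →₀ V) →ₗ[K] (G →₀ V))
    (hR : ∀ x, R ((uniformOp d c + finiteRowsOp d E b) x) = x) :
    ∃ N : Finset G, ∀ g h v, g⁻¹ * h ∉ N → R (Finsupp.single h v) g = 0 := by
  classical
  let D : (G →₀ V) →ₗ[K] (G →₀ V) := (LinearEquiv.ofBijective _ hC).symm
  have hCD : ∀ x, uniformOp d c (D x) = x := fun x =>
    (LinearEquiv.ofBijective _ hC).apply_symm_apply x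
  have hD : ∀ g x, D (Finsupp.mapDomain (g * ·) x) = Finsupp.mapDomain (g * ·) (D x) := by
    intro g x
    apply hC.1
    rw [hCD, uniformOp_translate, hCD]
  have hDsingle : ∀ h v g, D (Finsupp.single h v) g = D (Finsupp.single 1 v) (h⁻¹ * g) := by
    intro h v g
    rw [← mapDomain_mul_left_apply, ← hD, Finsupp.mapDomain_single, mul_one]
  -- Resolvent identity `R = D - R F D`: `R` and `D` agree on every `single h v` with `F (D (single
  -- h v)) = 0`, hence off the finite set `H` below.
  have hRD : ∀ x, R x = D x - R (finiteRowsOp d E b (D x)) := by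
    intro x
    have := hR (D x)
    rw [LinearMap.add_apply, hCD, map_add] at this
    exact eq_sub_of_add_eq this
  obtain ⟨S, hS⟩ := exists_support_bound D {1}
  set H := (E ×ˢ (Finset.univ : Finset ι) ×ˢ S).image
    fun p => p.1 * d p.2.1 * p.2.2⁻¹ with hH
  obtain ⟨U, hU⟩ := exists_support_bound R H
  refine ⟨S.image (·⁻¹) ∪ (U ×ˢ H).image fun p => p.1⁻¹ * p.2, fun g h v hgh => ?_⟩
  by_contra hne
  refine hgh (Finset.mem_union.2 ?_)
  by_cases hh : h ∈ H
  · exact Or.inr (Finset.mem_image.2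
      ⟨(g, h), Finset.mem_product.2 ⟨hU h hh v g hne, hh⟩, rfl⟩)
  · left
    have h0 : finiteRowsOp d E b (D (Finsupp.single h v)) = 0 := by
      ext g'
      rw [finiteRowsOp_apply]
      split_ifs with hg'
      · have : (fun i => D (Finsupp.single h v) (g' * d i)) = 0 := by
          funext i
          by_contra hi
          rw [hDsingle] at hi
          refine hh (Finset.mem_image.2 ⟨(g', i, h⁻¹ * (g' * d i)), ?_, by simp [mul_assoc]⟩)
          exact Finset.mem_product.2 ⟨hg', Finset.mem_product.2
            ⟨Finset.mem_univ i, hS 1 (Finset.mem_singleton_self 1) v _ hi⟩⟩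
        rw [this, map_zero]
        rfl
      · rfl
    rw [hRD, h0, map_zero, sub_zero, hDsingle] at hne
    exact Finset.mem_image.2 ⟨h⁻¹ * g, hS 1 (Finset.mem_singleton_self 1) v _ hne, by simp⟩

/-- Post-surjective linear cellular automata are surjective on finitely supported
configurations. -/
theorem PostSurjective.surjective_finsupp {M : Set G} {s : G → ((M → V) →ₗ[K] V)}
    (hs : PostSurjective (linearNuca s)) (T : (G →₀ V) →ₗ[K] (G →₀ V))
    (hT : ∀ x : G →₀ V, linearNuca s x = T x) : Function.Surjective T := by
  classical
  intro y
  have h0 : linearNuca s ((0 : G →₀ V) : G → V) = 0 := by rw [hT, map_zero]; rfl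
  obtain ⟨z, ⟨E, hE, hz⟩, hzy⟩ := hs ((0 : G →₀ V) : G → V) y
    ⟨y.support, y.support.finite_toSet, fun g hg => by
      rw [h0]
      exact Finsupp.notMem_support_iff.1 hg⟩
  let x : G →₀ V := Finsupp.ofSupportFinite z (hE.subset fun g hg => by
    by_contra hgE
    exact hg (hz g hgE))
  refine ⟨x, DFunLike.coe_injective ?_⟩
  rw [← hT, ← hzy]
  rfl

/-- In an infinite group some translation moves the finite exceptional set off any given finite
window. -/
theorem const_mem_orbitClosure [Infinite G] {A : Type*} {s : G → A} {c : A}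
    (hs : Asymptotic s fun _ => c) : (fun _ => c) ∈ orbitClosure s := by
  classical
  let _ : TopologicalSpace A := ⊥
  change (fun _ => c) ∈ closure (Set.range fun g : G => shift g s)
  obtain ⟨E, hE, hsE⟩ := hs
  rw [mem_closure_iff]
  intro o ho hc
  obtain ⟨I, u, hu, hIo⟩ := isOpen_pi_iff.1 ho _ hc
  obtain ⟨g, hg⟩ := Infinite.exists_notMem_finset
    ((I ×ˢ hE.toFinset).image fun p => p.1 * p.2⁻¹)
  refine ⟨shift g s, hIo fun i hi => ?_, g, rfl⟩
  have : g⁻¹ * i ∉ E := fun h => hg (Finset.mem_image.2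
    ⟨(i, g⁻¹ * i), Finset.mem_product.2 ⟨hi, hE.mem_toFinset.2 h⟩, by simp⟩)
  rw [shift, hsE _ this]
  exact (hu i hi).2

/-- The two cases of the theorem differ only in the proof that the limit constant automaton is
pre-injective. -/
theorem invertible_of_limit_injective [Finite V] {M : Set G} [Fintype M] [DecidableEq M]
    {s : G → ((M → V) →ₗ[K] V)} {c : (M → V) →ₗ[K] V} {E : Finset G}
    (hsE : ∀ g ∉ E, s g = c) (hs : PostSurjective (linearNuca s))
    (hinj : Infinite G →
      Function.Surjective (uniformOp (Subtype.val : M → G) c +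
        finiteRowsOp (Subtype.val : M → G) E fun g => s g - c) →
      Function.Injective (uniformOp (Subtype.val : M → G) c)) :
    Invertible (linearNuca s) := by
  classical
  have : FiniteDimensional K V := Module.Finite.of_finite
  set T := uniformOp (Subtype.val : M → G) c +
    finiteRowsOp (Subtype.val : M → G) E fun g => s g - c with hTdef
  have hT : ∀ x : G →₀ V, linearNuca s x = T x := by
    intro x
    funext g
    rw [hTdef, LinearMap.add_apply, Finsupp.add_apply, uniformOp_apply, finiteRowsOp_apply]
    simp only [linearNuca, nuca, shift, inv_inv]
    split_ifs with hg
    · simp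
    · rw [hsE g hg, add_zero]
  have hTs := hs.surjective_finsupp T hT
  have hbij : Function.Bijective T ∧ ∀ R : (G →₀ V) →ₗ[K] (G →₀ V), (∀ x, R (T x) = x) →
      ∃ N : Finset G, ∀ g h v, g⁻¹ * h ∉ N → R (Finsupp.single h v) g = 0 := by
    cases finite_or_infinite G with
    | inl _ =>
      have := Fintype.ofFinite G
      exact ⟨⟨LinearMap.injective_iff_surjective.2 hTs, hTs⟩, fun R _ =>
        ⟨Finset.univ, fun g h v hn => absurd (Finset.mem_univ _) hn⟩⟩
    | inr hG =>
      obtain ⟨hC, hTb⟩ := bijective_of_injective_of_surjective_add _ _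
        (finiteRowsOp_range_finite _ _ _) (hinj hG hTs) hTs
      exact ⟨hTb, fun R hR => exists_memory_inverse _ _ _ _ hC R hR⟩
  let e := LinearEquiv.ofBijective T hbij.1
  obtain ⟨N, hN⟩ := hbij.2 e.symm fun x => e.symm_apply_apply x
  exact invertible_of_finsupp_inverse (Set.toFinite M) s T e.symm hT
    (fun x => e.apply_symm_apply x) (fun x => e.symm_apply_apply x) N hN

end NUCA

theorem theoremD {G : Type*} [Group G] [Countable G]
    {K V : Type*} [Field K] [AddCommGroup V] [Module K V] [Finite V]
    (M : Set G) (hM : M.Finite)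
    (s : G → ((M → V) →ₗ[K] V))
    (hs : ∃ c : (M → V) →ₗ[K] V, NUCA.Asymptotic s (fun _ => c)) :
    (NUCA.IsAmenable G → NUCA.PostSurjective (NUCA.linearNuca s) →
      NUCA.Invertible (NUCA.linearNuca s)) ∧
    (Group.ResiduallyFinite G → NUCA.StablyPostSurjective s →
      NUCA.Invertible (NUCA.linearNuca s)) := by
  classical
  have := hM.fintype
  have : FiniteDimensional K V := Module.Finite.of_finite
  obtain ⟨c, hc⟩ := hs
  obtain ⟨E, hE, hsE⟩ := id hc
  lift E to Finset G using hE
  have hsE' : ∀ g ∉ E, s g = c := fun g hg => hsE g hg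
  refine ⟨fun hG hpost => ?_, fun hG hstable => ?_⟩
  · refine NUCA.invertible_of_limit_injective hsE' hpost fun _ hsurj => ?_
    refine NUCA.uniformOp_injective_of_isAmenable hG _ c _
      (NUCA.finiteRowsOp_range_finite _ _ _) (fun x g hx => ?_) hsurj
    rw [NUCA.finiteRowsOp_apply]
    split_ifs
    · simp only [hx]
      exact map_zero _
    · rfl
  · have hpost : NUCA.PostSurjective (NUCA.linearNuca s) :=
      hstable s (@subset_closure _ (_) _ _ ⟨1, by funext h; simp [NUCA.shift]⟩)
    refine NUCA.invertible_of_limit_injective hsE' hpost fun _ _ => ?_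
    refine NUCA.uniformOp_injective_of_residuallyFinite _ c ?_
    refine (hstable _ (NUCA.const_mem_orbitClosure hc)).surjective_finsupp _ fun x => ?_
    funext g
    simp only [NUCA.uniformOp_apply, NUCA.linearNuca, NUCA.nuca, NUCA.shift, inv_inv]
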